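/- Let $G=(V,E)$ be a connected simple graph. A 2-colouring of $G$ is a map $c\colon V\to\{0,1\}$; it is called distinguishing if the only automorphism $\varphi$ of $G$ with $c\circ\varphi=c$ is the identity. In a random 2-colouring every vertex receives one of the two colours independently and uniformly, that is, $c$ is distributed according to the product measure on $\{0,1\}^V$ of the uniform measures on $\{0,1\}$. For $v_0\in V$ and $n\in\mathbb N$ let $B_{v_0}(n)$ be the set of all vertices at graph distance at most $n$ from $v_0$. **Theorem.** Assume that $G$ has infinite motion, i.e. every non-trivial automorphism of $G$ moves infinitely many vertices. Let $\varepsilon>0$ and assume that $G$ has growth $\mathcal O\bigl(2^{(\frac12-\varepsilon)\sqrt n}\bigr)$, i.e. there are a vertex $v_0\in V$ and a constant $C$ such that for every $n\in\mathbb N$ the ball $B_{v_0}(n)$ is finite and $$|B_{v_0}(n)|\le C\,2^{(\frac12-\varepsilon)\sqrt n}.$$ (In particular, $G$ is locally finite.) Then a random 2-colouring of $G$ is almost surely distinguishing. -/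

import Mathlib

open MeasureTheory

namespace SimpleGraph

variable {V : Type*}

/-- The motion of an automorphism: the number of vertices that it does not fix. -/
noncomputable def autMotion {G : SimpleGraph V} (φ : G ≃g G) : ℕ∞ :=
  {v : V | φ v ≠ v}.encard

/-- The motion of a graph: the minimal motion of a non-trivial automorphism
(`⊤` if there is no non-trivial automorphism). -/
noncomputable def motion (G : SimpleGraph V) : ℕ∞ :=
  ⨅ (φ : G ≃g G) (_ : φ ≠ RelIso.refl G.Adj), autMotion φ

/-- Every non-trivial automorphism moves infinitely many vertices. -/
def InfiniteMotion (G : SimpleGraph V) : Prop :=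
  G.motion = ⊤

/-- The vertices at graph distance at most `n` from `v₀`. Vertices in other components are at
infinite distance. -/
def distBall (G : SimpleGraph V) (v₀ : V) (n : ℕ) : Set V :=
  {v : V | G.edist v₀ v ≤ n}

/-- `G` has growth `f`: for some vertex `v₀` and some constant `C`, every ball of radius `n`
around `v₀` is finite and has at most `C * f n` elements. -/
def HasGrowth (G : SimpleGraph V) (f : ℕ → ℝ) : Prop :=
  ∃ (v₀ : V) (C : ℝ), ∀ n : ℕ,
    (G.distBall v₀ n).Finite ∧ ((G.distBall v₀ n).ncard : ℝ) ≤ C * f n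

/-- A colouring is distinguishing if no non-trivial automorphism preserves it. -/
def IsDistinguishing {C : Type*} (G : SimpleGraph V) (c : V → C) : Prop :=
  ∀ φ : G ≃g G, c ∘ φ = c → φ = RelIso.refl G.Adj

end SimpleGraph

/-- The law of a random 2-colouring of `V`: each vertex is coloured independently and uniformly,
that is, the product over all vertices of the uniform probability measure on the two colours. -/
noncomputable def randomColouring (V : Type*) : Measure (V → Bool) :=
  Measure.infinitePi fun _ : V => (PMF.uniformOfFintype Bool).toMeasure

/-! The moved vertices of a colour-preserving automorphism `φ ≠ id` cannot accumulate quickly: the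
growth bound forces infinitely many radii `m` at which the moved part of the sphere is nonempty but
smaller than the moved part of the ball by a factor `3√m` (`exists_ge_mul_increment_le`). Infinite
motion makes `φ` rigid: its values at the centre and on the sphere determine it on the ball
(`InfiniteMotion.eq_on_ball_of_eq_on_sphere`).

Hence a union bound needs only `w = φ v` and the graph `P` of `φ` on the moved part of the sphere. A
map moving `t` vertices of the ball preserves a random colouring there with probability at most
`2^(-t/3)`, which sparsity bounds by `q^|P|` with `q = 2^(-√m)`. There are `N = O(2^(2a√m))`
possible pairs, `a < 1/2`, so summing over nonempty `P` gives `(1+q)^N - 1 = O(2^(-(1-2a)√m))`. This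
is summable in `m`, and Borel–Cantelli applies for each of the countably many `w`, although the
automorphism group may be uncountable. -/

/-! ### Probability that a random colouring is preserved by a permutation -/

theorem exists_disjoint_map_of_moved {V : Type*} (φ : V ≃ V) (M : Finset V)
    (hM : ∀ x ∈ M, φ x ≠ x) :
    ∃ X ⊆ M, (∀ x ∈ X, φ x ∉ X) ∧ M.card ≤ 3 * X.card := by
  classical
  obtain ⟨X, hX⟩ := (M.powerset.filter fun X => ∀ x ∈ X, φ x ∉ X).exists_maximal
    ⟨∅, by simp⟩
  have hX1 := hX.1
  simp only [Finset.mem_filter, Finset.mem_powerset] at hX1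
  refine ⟨X, hX1.1, hX1.2, ?_⟩
  -- Any other point of `M` could be added to `X`, against maximality; the three sets give the
  -- factor 3.
  have hsub : M ⊆ X ∪ X.image φ ∪ X.image φ.symm := by
    intro y hy
    by_contra hcon
    simp only [Finset.mem_union, Finset.mem_image, not_or, not_exists, not_and] at hcon
    obtain ⟨⟨h1, h2⟩, h3⟩ := hcon
    have hmem : insert y X ∈ M.powerset.filter fun X => ∀ x ∈ X, φ x ∉ X := by
      simp only [Finset.mem_filter, Finset.mem_powerset, Finset.insert_subset_iff,
        Finset.mem_insert]
      refine ⟨⟨hy, hX1.1⟩, ?_⟩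
      rintro x (rfl | hx) (h | h)
      · exact hM _ hy h
      · exact h3 _ h (by simp)
      · exact h2 _ hx h
      · exact hX1.2 x hx h
    exact h1 (hX.2 hmem (Finset.subset_insert y X) (Finset.mem_insert_self y X))
  calc M.card ≤ (X ∪ X.image φ ∪ X.image φ.symm).card := Finset.card_le_card hsub
    _ ≤ X.card + (X.image φ).card + (X.image φ.symm).card :=
      (Finset.card_union_le _ _).trans (Nat.add_le_add_right (Finset.card_union_le _ _) _)
    _ ≤ 3 * X.card := by
      have := Finset.card_image_le (s := X) (f := φ)
      have := Finset.card_image_le (s := X) (f := φ.symm)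
      omega

theorem randomColouring_cylinder {V : Type*} (s : Finset V) (a : V → Bool) :
    randomColouring V {c | ∀ x ∈ s, c x = a x} = (2⁻¹ : ENNReal) ^ s.card := by
  have h := Measure.infinitePi_pi (fun _ : V => (PMF.uniformOfFintype Bool).toMeasure)
    (s := s) (t := fun x => {a x}) (fun _ _ => MeasurableSet.of_discrete)
  have hs : (s : Set V).pi (fun x => {a x}) = {c : V → Bool | ∀ x ∈ s, c x = a x} := by
    ext c; simp [Set.mem_pi]
  rw [hs] at h
  rw [randomColouring, h]
  simp

/-- The colours on `X` dictate those on the disjoint set `φ(X)`: there are `2^|X|` choices, each a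
cylinder on `2|X|` vertices. -/
theorem randomColouring_disjoint_map_le {V : Type*} (φ : V ≃ V) (X : Finset V)
    (hX : ∀ x ∈ X, φ x ∉ X) :
    randomColouring V {c | ∀ x ∈ X, c (φ x) = c x} ≤ (2⁻¹ : ENNReal) ^ X.card := by
  classical
  have hdisj : Disjoint X (X.map φ.toEmbedding) := by
    rw [Finset.disjoint_left]
    intro x hx hx'
    obtain ⟨y, hy, rfl⟩ := Finset.mem_map.1 hx'
    exact hX y hy hx
  let a : Finset V → V → Bool := fun A x => decide (x ∈ A ∨ φ.symm x ∈ A)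
  have hsub : {c : V → Bool | ∀ x ∈ X, c (φ x) = c x} ⊆
      ⋃ A ∈ X.powerset, {c | ∀ x ∈ X ∪ X.map φ.toEmbedding, c x = a A x} := by
    intro c hc
    simp only [Set.mem_iUnion]
    refine ⟨X.filter (fun x => c x = true), by simp, ?_⟩
    intro x hx
    rcases Finset.mem_union.1 hx with hx | hx
    · have : φ.symm x ∉ X := fun h => hX _ h (by simpa using hx)
      simp [a, hx, this]
    · obtain ⟨y, hy, rfl⟩ := Finset.mem_map.1 hx
      have h1 : φ y ∉ X := hX y hy
      have h2 : c (φ y) = c y := hc y hy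
      simp [a, hy, h1, h2]
  calc randomColouring V {c | ∀ x ∈ X, c (φ x) = c x}
      ≤ ∑ A ∈ X.powerset,
          randomColouring V {c | ∀ x ∈ X ∪ X.map φ.toEmbedding, c x = a A x} :=
        (measure_mono hsub).trans (measure_biUnion_finset_le _ _)
    _ = 2 ^ X.card * ((2⁻¹ : ENNReal) ^ X.card * (2⁻¹ : ENNReal) ^ X.card) := by
        simp only [randomColouring_cylinder, Finset.card_union_of_disjoint hdisj,
          Finset.card_map, pow_add, Finset.sum_const, Finset.card_powerset, nsmul_eq_mul]
        push_cast
        rfl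
    _ = (2⁻¹ : ENNReal) ^ X.card := by
        rw [← mul_assoc, ← mul_pow, ENNReal.mul_inv_cancel (by simp) (by simp), one_pow, one_mul]

theorem randomColouring_moved_le {V : Type*} (φ : V ≃ V) (M : Finset V)
    (hM : ∀ x ∈ M, φ x ≠ x) :
    ∃ k : ℕ, M.card ≤ 3 * k ∧
      randomColouring V {c | ∀ x ∈ M, c (φ x) = c x} ≤ (2⁻¹ : ENNReal) ^ k := by
  obtain ⟨X, hXM, hX, hcard⟩ := exists_disjoint_map_of_moved φ M hM
  refine ⟨X.card, hcard, le_trans (measure_mono fun c hc x hx => hc x (hXM hx))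
    (randomColouring_disjoint_map_le φ X hX)⟩

/-! ### Rigidity of automorphisms under infinite motion -/

namespace SimpleGraph

variable {V : Type*} {G : SimpleGraph V}

theorem InfiniteMotion.eq_refl_of_finite (h : G.InfiniteMotion) (φ : G ≃g G)
    (hφ : {v | φ v ≠ v}.Finite) : φ = RelIso.refl G.Adj := by
  by_contra hne
  have h1 : autMotion φ = ⊤ := by
    have := h
    rw [InfiniteMotion, motion, iInf_eq_top] at this
    exact iInf_eq_top.1 (this φ) hne
  rw [autMotion, Set.encard_eq_top_iff] at h1
  exact h1 hφ

theorem Adj.dist_le_succ (hconn : G.Connected) {x y : V} (h : G.Adj x y) (v : V) :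
    G.dist v y ≤ G.dist v x + 1 := by
  have := hconn.dist_triangle (u := v) (v := x) (w := y)
  rwa [dist_eq_one_iff_adj.2 h] at this

theorem Connected.exists_adj_dist_eq (hconn : G.Connected) {v x : V} {n : ℕ}
    (h : G.dist v x = n + 1) : ∃ y, G.Adj y x ∧ G.dist v y = n := by
  obtain ⟨p, hp⟩ := hconn.exists_walk_length_eq_dist x v
  cases p with
  | nil => simp at h
  | @cons _ y _ hadj q =>
    refine ⟨y, hadj.symm, le_antisymm ?_ ?_⟩
    · have := dist_le q
      rw [Walk.length_cons, dist_comm] at hp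
      rw [dist_comm]; omega
    · have := hadj.symm.dist_le_succ hconn v
      omega

/-- An automorphism that fixes a sphere pointwise and does not move its centre out of the sphere
maps the open ball into itself. -/
theorem dist_map_lt_of_fix_sphere (hconn : G.Connected) (φ : G ≃g G) {v : V} {m : ℕ}
    (hv : G.dist v (φ v) < m) (hfix : ∀ x, G.dist v x = m → φ x = x) (x : V)
    (hx : G.dist v x < m) : G.dist v (φ x) < m := by
  induction hn : G.dist v x generalizing x with
  | zero =>
    obtain rfl := hconn.dist_eq_zero_iff.1 hn
    exact hv
  | succ n ih =>
    obtain ⟨y, hyx, hy⟩ := hconn.exists_adj_dist_eq hn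
    have h1 := ih y (by omega) hy
    have h2 := (φ.map_adj_iff.2 hyx).dist_le_succ hconn v
    by_contra hcon
    have h3 : G.dist v (φ x) = m := by omega
    have h4 := φ.injective (hfix _ h3)
    rw [h4] at h3
    omega

/-- The sphere separates inside from outside, so `φ` on the ball glued to the identity elsewhere is
again an automorphism. It moves finitely many vertices, hence is trivial. -/
theorem InfiniteMotion.fix_ball_of_fix_sphere (hmot : G.InfiniteMotion) (hconn : G.Connected)
    (φ : G ≃g G) {v : V} {m : ℕ} (hfin : {x | G.dist v x ≤ m}.Finite)
    (hv : G.dist v (φ v) < m) (hfix : ∀ x, G.dist v x = m → φ x = x) (x : V)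
    (hx : G.dist v x ≤ m) : φ x = x := by
  classical
  have hfin' : {x | G.dist v x < m}.Finite := hfin.subset fun x (hx : G.dist v x < m) => hx.le
  have hmaps := dist_map_lt_of_fix_sphere hconn φ hv hfix
  have hsurj : Set.SurjOn φ {x | G.dist v x < m} {x | G.dist v x < m} :=
    (Set.eq_of_subset_of_ncard_le (Set.MapsTo.image_subset fun x hx => hmaps x hx)
      (Set.ncard_image_of_injective _ φ.injective).ge hfin').ge
  have hiff : ∀ x, G.dist v (φ x) < m ↔ G.dist v x < m := by
    refine fun x => ⟨fun h => ?_, hmaps x⟩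
    obtain ⟨y, hy, hyx⟩ := hsurj h
    rwa [← φ.injective hyx]
  let σ : Equiv.Perm V := Equiv.Perm.ofSubtype
    (Equiv.Perm.subtypePerm (p := fun x => G.dist v x < m) φ.toEquiv hiff)
  have hin : ∀ x, G.dist v x ≤ m → σ x = φ x := by
    intro x hx
    rcases hx.lt_or_eq with hx | hx
    · exact Equiv.Perm.ofSubtype_apply_of_mem (p := fun x => G.dist v x < m) _ hx
    · rw [hfix x hx]
      exact Equiv.Perm.ofSubtype_apply_of_not_mem _ (by omega)
  have hout : ∀ x, m ≤ G.dist v x → σ x = x := fun x hx =>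
    Equiv.Perm.ofSubtype_apply_of_not_mem _ (by omega)
  -- Both sides are false: an edge changes the distance to `v` by at most one.
  have hfar : ∀ x y, G.dist v x < m → m < G.dist v y → (G.Adj (σ x) (σ y) ↔ G.Adj x y) := by
    intro x y hx hy
    rw [hin x hx.le, hout y hy.le]
    have := hmaps x hx
    refine ⟨fun h => ?_, fun h => ?_⟩
    · have := h.dist_le_succ hconn v; omega
    · have := h.dist_le_succ hconn v; omega
  have hadj : ∀ {x y}, G.Adj (σ x) (σ y) ↔ G.Adj x y := by
    intro x y
    rcases lt_or_ge m (G.dist v x) with hx | hx <;> rcases lt_or_ge m (G.dist v y) with hy | hy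
    · rw [hout x hx.le, hout y hy.le]
    · rcases hy.lt_or_eq with hy | hy
      · rw [G.adj_comm, hfar y x hy hx, G.adj_comm]
      · rw [hout x hx.le, hout y hy.ge]
    · rcases hx.lt_or_eq with hx | hx
      · exact hfar x y hx hy
      · rw [hout x hx.ge, hout y hy.le]
    · rw [hin x hx, hin y hy, φ.map_adj_iff]
  have htriv := hmot.eq_refl_of_finite ⟨σ, hadj⟩ (hfin'.subset fun x hx => by
    by_contra h
    exact hx (hout x (not_lt.1 h)))
  rw [← hin x hx]
  exact congrArg (fun ψ : G ≃g G => ψ x) htriv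

theorem InfiniteMotion.eq_on_ball_of_eq_on_sphere (hmot : G.InfiniteMotion)
    (hconn : G.Connected) (φ ψ : G ≃g G) {v : V} {m : ℕ} (hm : 0 < m)
    (hfin : {x | G.dist v x ≤ m}.Finite) (hv : φ v = ψ v)
    (heq : ∀ x, G.dist v x = m → φ x = ψ x) (x : V) (hx : G.dist v x ≤ m) : φ x = ψ x := by
  have h := hmot.fix_ball_of_fix_sphere hconn (φ.trans ψ.symm) hfin
    (by simpa [hv] using hm) (fun x hx => by simp [heq x hx]) x hx
  simpa [RelIso.symm_apply_eq] using h

end SimpleGraph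

/-! ### Analytic estimates -/

/-- A monotone sequence of growth `2 ^ (√n / 2)` has, infinitely often, increments that are small
relative to its values: otherwise it would grow like `exp (2 √n / 3)`. -/
theorem exists_ge_mul_increment_le {T : ℕ → ℝ} {C a : ℝ} (ha : a ≤ 1 / 2) (hC : 0 ≤ C)
    (hT : ∀ n, T n ≤ C * 2 ^ (a * √(n : ℝ))) {M : ℕ} (hM : 0 < T M) (hmono : Monotone T) :
    ∃ m ≥ M, 3 * √((m + 1 : ℕ) : ℝ) * (T (m + 1) - T m) ≤ T (m + 1) := by
  by_contra! hcon
  -- The index shift in the exponent is what makes concavity usable: `√(m+2) - √(m+1) ≤ 1 /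
  -- (2√(m+1))`, with the same root as in the increment bound.
  have hstep : ∀ m ≥ M, T m * Real.exp (-(2 / 3 * √((m + 1 : ℕ) : ℝ))) ≤
      T (m + 1) * Real.exp (-(2 / 3 * √((m + 1 + 1 : ℕ) : ℝ))) := by
    intro m hm
    have h := hcon m hm
    have hTm : 0 < T m := hM.trans_le (hmono hm)
    set s := √((m + 1 : ℕ) : ℝ) with hs
    set r := √((m + 1 + 1 : ℕ) : ℝ) with hr
    have hs2 : s ^ 2 = m + 1 := by rw [hs, Real.sq_sqrt (by positivity)]; push_cast; ring
    have hr2 : r ^ 2 = m + 2 := by rw [hr, Real.sq_sqrt (by positivity)]; push_cast; ring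
    have hs0 : 0 < s := by rw [hs]; positivity
    have hr0 : 0 < r := by rw [hr]; positivity
    have hrs : s * (2 * (r - s)) ≤ 1 := by nlinarith [sq_nonneg (r - s)]
    have hexp : 1 - 1 / (3 * s) ≤ Real.exp (-(2 / 3 * (r - s))) := by
      have h1 := Real.add_one_le_exp (-(2 / 3 * (r - s)))
      have h2 : 2 / 3 * (r - s) ≤ 1 / (3 * s) := by
        rw [le_div_iff₀ (by positivity)]; nlinarith
      linarith
    have h3 : T m ≤ T (m + 1) * (1 - 1 / (3 * s)) := by
      have : T (m + 1) * (1 / (3 * s)) ≤ T (m + 1) - T m := by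
        rw [mul_one_div, div_le_iff₀ (by positivity)]; nlinarith
      linarith
    have h4 : T m ≤ T (m + 1) * Real.exp (-(2 / 3 * (r - s))) :=
      h3.trans (mul_le_mul_of_nonneg_left hexp (hTm.le.trans (hmono (Nat.le_succ m))))
    calc T m * Real.exp (-(2 / 3 * s))
        ≤ T (m + 1) * Real.exp (-(2 / 3 * (r - s))) * Real.exp (-(2 / 3 * s)) :=
          mul_le_mul_of_nonneg_right h4 (Real.exp_pos _).le
      _ = _ := by rw [mul_assoc, ← Real.exp_add]; ring_nf
  set κ := T M * Real.exp (-(2 / 3 * √((M + 1 : ℕ) : ℝ))) with hκ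
  have hκ0 : 0 < κ := mul_pos hM (Real.exp_pos _)
  have hlow : ∀ m ≥ M, κ ≤ T m * Real.exp (-(2 / 3 * √((m + 1 : ℕ) : ℝ))) := by
    intro m hm
    induction m, hm using Nat.le_induction with
    | base => exact le_rfl
    | succ m hm ih => exact ih.trans (hstep m hm)
  have hup : ∀ m ≥ M, κ ≤ C * Real.exp (-(1 / 4 * √(m : ℝ))) := by
    intro m hm
    have h0 : (0 : ℝ) ≤ √(m : ℝ) := Real.sqrt_nonneg _
    have h1 : √(m : ℝ) ≤ √((m + 1 : ℕ) : ℝ) := Real.sqrt_le_sqrt (by push_cast; linarith)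
    calc κ ≤ T m * Real.exp (-(2 / 3 * √((m + 1 : ℕ) : ℝ))) := hlow m hm
      _ ≤ C * 2 ^ (a * √(m : ℝ)) * Real.exp (-(2 / 3 * √((m + 1 : ℕ) : ℝ))) :=
        mul_le_mul_of_nonneg_right (hT m) (Real.exp_pos _).le
      _ = C * Real.exp (Real.log 2 * (a * √(m : ℝ)) + -(2 / 3 * √((m + 1 : ℕ) : ℝ))) := by
        rw [Real.rpow_def_of_pos two_pos, mul_assoc, ← Real.exp_add]
      _ ≤ C * Real.exp (-(1 / 4 * √(m : ℝ))) := by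
        refine mul_le_mul_of_nonneg_left (Real.exp_le_exp.2 ?_) hC
        have hl := Real.log_two_lt_d9
        have hl0 : 0 < Real.log 2 := Real.log_pos one_lt_two
        -- `log 2 / 2 < 0.4`, and `2/3 - 0.4 > 1/4` leaves exponential decay in `√m`.
        have : Real.log 2 * (a * √(m : ℝ)) ≤ 0.4 * √(m : ℝ) := by
          have : Real.log 2 * a ≤ 0.4 := by nlinarith
          nlinarith
        linarith
  have hlim : Filter.Tendsto (fun m : ℕ => C * Real.exp (-(1 / 4 * √(m : ℝ)))) Filter.atTop
      (nhds (C * 0)) := by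
    refine Filter.Tendsto.const_mul C (Real.tendsto_exp_neg_atTop_nhds_zero.comp ?_)
    exact Filter.Tendsto.const_mul_atTop (by norm_num)
      (Real.tendsto_sqrt_atTop.comp tendsto_natCast_atTop_atTop)
  have := ge_of_tendsto hlim (Filter.eventually_atTop.2 ⟨M, hup⟩)
  linarith

theorem summable_two_rpow_neg_mul_sqrt {b : ℝ} (hb : 0 < b) :
    Summable fun n : ℕ => (2 : ℝ) ^ (-(b * √(n : ℝ))) := by
  have hb' : 0 < Real.log 2 * b := mul_pos (Real.log_pos one_lt_two) hb
  refine summable_of_isBigO_nat (g := fun n : ℕ => (n : ℝ) ^ (-2 : ℝ))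
    (Real.summable_nat_rpow.2 (by norm_num)) ?_
  -- The exponent `-4` in `√n` becomes `-2` in `n`.
  have h := (isLittleO_exp_neg_mul_rpow_atTop hb' (-4)).isBigO.comp_tendsto
    (Real.tendsto_sqrt_atTop.comp tendsto_natCast_atTop_atTop)
  refine h.congr (fun n => ?_) (fun n => ?_)
  · simp only [Function.comp_apply, Real.rpow_def_of_pos two_pos]
    ring_nf
  · simp only [Function.comp_apply]
    rw [Real.sqrt_eq_rpow, ← Real.rpow_mul (Nat.cast_nonneg n)]
    norm_num

theorem one_add_pow_sub_one_le {q : ℝ} (hq : 0 ≤ q) {N : ℕ} {K : ℝ} (hK : N * q ≤ K) :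
    (1 + q) ^ N - 1 ≤ N * q * Real.exp K := by
  have h1 : (1 + q) ^ N ≤ Real.exp (N * q) := by
    rw [Real.exp_nat_mul]
    exact pow_le_pow_left₀ (by positivity) (by linarith [Real.add_one_le_exp q]) N
  have h2 : Real.exp (N * q) - 1 ≤ N * q * Real.exp (N * q) := by
    have h3 := Real.add_one_le_exp (-(N * q))
    have h4 := mul_le_mul_of_nonneg_right h3 (Real.exp_pos (N * q)).le
    rw [← Real.exp_add, neg_add_cancel, Real.exp_zero] at h4
    linarith
  have h5 : N * q * Real.exp (N * q) ≤ N * q * Real.exp K :=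
    mul_le_mul_of_nonneg_left (Real.exp_le_exp.2 hK) (by positivity)
  linarith

theorem sum_powerset_erase_empty_pow {α : Type*} [DecidableEq α] (s : Finset α) (q : ℝ) :
    ∑ P ∈ s.powerset.erase ∅, q ^ P.card = (1 + q) ^ s.card - 1 := by
  have h := Finset.sum_pow_mul_eq_add_pow q 1 s
  simp only [one_pow, mul_one] at h
  rw [add_comm, ← h, ← Finset.add_sum_erase _ _ (Finset.empty_mem_powerset s)]
  simp

/-! ### Union bound over the actions on a sphere -/

namespace SimpleGraph

variable {V : Type*} {G : SimpleGraph V}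

/-- The vertices at distance at most `m` from `v` that `φ` moves. -/
def movedOnBall (φ : G ≃g G) (v : V) (m : ℕ) : Set V :=
  {x | G.dist v x ≤ m ∧ φ x ≠ x}

/-- The vertices at distance exactly `m` from `v` that `φ` moves. -/
def movedOnSphere (φ : G ≃g G) (v : V) (m : ℕ) : Set V :=
  {x | G.dist v x = m ∧ φ x ≠ x}

/-- The colourings that are preserved on the ball of radius `m` around `v` by an automorphism
mapping `v` to `w` that moves some vertex of the sphere of radius `m`, but few compared with the
ball. -/
def sparselyPreserved (G : SimpleGraph V) (v w : V) (m : ℕ) : Set (V → Bool) :=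
  {c | G.dist v w < m ∧ ∃ φ : G ≃g G, φ v = w ∧ (movedOnSphere φ v m).Nonempty ∧
    3 * √(m : ℝ) * (movedOnSphere φ v m).ncard ≤ (movedOnBall φ v m).ncard ∧
    ∀ x, G.dist v x ≤ m → c (φ x) = c x}

theorem movedOnBall_finite {v : V} {m : ℕ} (hfin : {x | G.dist v x ≤ m}.Finite) (φ : G ≃g G) :
    (movedOnBall φ v m).Finite :=
  hfin.subset fun _ hx => hx.1

theorem movedOnSphere_finite {v : V} {m : ℕ} (hfin : {x | G.dist v x ≤ m}.Finite)
    (φ : G ≃g G) : (movedOnSphere φ v m).Finite :=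
  hfin.subset fun _ hx => hx.1.le

theorem ncard_movedOnBall_succ {v : V} {m : ℕ} (hfin : {x | G.dist v x ≤ m + 1}.Finite)
    (φ : G ≃g G) : (movedOnBall φ v (m + 1)).ncard =
      (movedOnBall φ v m).ncard + (movedOnSphere φ v (m + 1)).ncard := by
  have hfin' : {x | G.dist v x ≤ m}.Finite :=
    hfin.subset fun x (hx : G.dist v x ≤ m) => hx.trans (Nat.le_succ m)
  rw [← Set.ncard_union_eq _ (movedOnBall_finite hfin' φ) (movedOnSphere_finite hfin φ)]
  · congr 1
    ext x
    simp only [movedOnBall, movedOnSphere, Set.mem_union, Set.mem_ofPred_eq, Nat.le_succ_iff]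
    tauto
  · rw [Set.disjoint_left]
    intro x hx hx'
    have h1 := hx.1
    have h2 := hx'.1
    omega

/-- The graph of `φ` on the vertices of a sphere that it moves. -/
def movedGraphOnSphere (φ : G ≃g G) (v : V) (m : ℕ) : Set (V × V) :=
  (fun x => (x, φ x)) '' movedOnSphere φ v m

theorem ncard_movedGraphOnSphere (φ : G ≃g G) (v : V) (m : ℕ) :
    (movedGraphOnSphere φ v m).ncard = (movedOnSphere φ v m).ncard :=
  Set.ncard_image_of_injective _ fun _ _ h => congrArg Prod.fst h

theorem eq_of_mem_movedGraphOnSphere {φ : G ≃g G} {v x y : V} {m : ℕ}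
    (h : (x, y) ∈ movedGraphOnSphere φ v m) : φ x = y := by
  obtain ⟨z, -, hz⟩ := h
  simp only [Prod.mk.injEq] at hz
  rw [← hz.1, hz.2]

theorem eq_on_sphere_of_movedGraphOnSphere_eq {φ ψ : G ≃g G} {v : V} {m : ℕ}
    (h : movedGraphOnSphere φ v m = movedGraphOnSphere ψ v m) (x : V) (hx : G.dist v x = m) :
    φ x = ψ x := by
  by_cases h1 : φ x = x
  · by_cases h2 : ψ x = x
    · rw [h1, h2]
    · have hmem : (x, ψ x) ∈ movedGraphOnSphere ψ v m := ⟨x, ⟨hx, h2⟩, rfl⟩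
      rw [← h] at hmem
      exact eq_of_mem_movedGraphOnSphere hmem
  · have hmem : (x, φ x) ∈ movedGraphOnSphere φ v m := ⟨x, ⟨hx, h1⟩, rfl⟩
    rw [h] at hmem
    exact (eq_of_mem_movedGraphOnSphere hmem).symm

/-- By rigidity all admissible `φ` agree on the ball with a single `ψ`, so the event is no likelier
than preservation by `ψ` alone. -/
theorem measure_preserved_of_movedGraph_le (hmot : G.InfiniteMotion) (hconn : G.Connected)
    {v w : V} {m : ℕ} (hm : 0 < m) (hfin : {x | G.dist v x ≤ m}.Finite) (P : Finset (V × V)) :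
    randomColouring V {c | ∃ φ : G ≃g G, φ v = w ∧ movedGraphOnSphere φ v m = P ∧
      3 * √(m : ℝ) * (movedOnSphere φ v m).ncard ≤ (movedOnBall φ v m).ncard ∧
      ∀ x, G.dist v x ≤ m → c (φ x) = c x} ≤
    ENNReal.ofReal (((2 : ℝ) ^ (-√(m : ℝ))) ^ P.card) := by
  rcases Set.eq_empty_or_nonempty {c : V → Bool | ∃ φ : G ≃g G, φ v = w ∧
      movedGraphOnSphere φ v m = P ∧
      3 * √(m : ℝ) * (movedOnSphere φ v m).ncard ≤ (movedOnBall φ v m).ncard ∧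
      ∀ x, G.dist v x ≤ m → c (φ x) = c x} with h | ⟨-, ψ, hψv, hψP, hψ, -⟩
  · rw [h]; simp
  have hball := movedOnBall_finite hfin ψ
  obtain ⟨k, hk, hle⟩ := randomColouring_moved_le ψ.toEquiv hball.toFinset
    (fun x hx => (hball.mem_toFinset.1 hx).2)
  refine (measure_mono ?_).trans (hle.trans ?_)
  · rintro c ⟨φ, hφv, hφP, -, hc⟩ x hx
    have hx' := (hball.mem_toFinset.1 hx).1
    have := hmot.eq_on_ball_of_eq_on_sphere hconn φ ψ hm hfin (hφv.trans hψv.symm)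
      (eq_on_sphere_of_movedGraphOnSphere_eq (hφP.trans hψP.symm)) x hx'
    have h := hc x hx'
    rw [this] at h
    exact h
  · have hcard : (movedOnSphere ψ v m).ncard = P.card := by
      rw [← ncard_movedGraphOnSphere, hψP, Set.ncard_coe_finset]
    rw [← Set.ncard_eq_toFinset_card _ hball] at hk
    have hk' : ((movedOnBall ψ v m).ncard : ℝ) ≤ 3 * k := by exact_mod_cast hk
    rw [hcard] at hψ
    have hexp : √(m : ℝ) * P.card ≤ k := by linarith
    calc (2⁻¹ : ENNReal) ^ k = ENNReal.ofReal ((2⁻¹ : ℝ) ^ k) := by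
          rw [ENNReal.ofReal_pow (by positivity), ENNReal.ofReal_inv_of_pos two_pos]
          simp
      _ ≤ _ := by
          refine ENNReal.ofReal_le_ofReal ?_
          rw [← Real.rpow_mul_natCast (by norm_num), inv_pow, ← Real.rpow_natCast,
            ← Real.rpow_neg (by norm_num)]
          exact Real.rpow_le_rpow_of_exponent_le one_le_two (by linarith)

theorem measure_sparselyPreserved_le (hmot : G.InfiniteMotion) (hconn : G.Connected) {v : V}
    (hfin : ∀ n, {x | G.dist v x ≤ n}.Finite) (w : V) (m : ℕ) :
    randomColouring V (G.sparselyPreserved v w m) ≤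
      ENNReal.ofReal ((1 + (2 : ℝ) ^ (-√(m : ℝ))) ^
        ({x | G.dist v x ≤ m}.ncard * {x | G.dist v x ≤ m + G.dist v w}.ncard) - 1) := by
  classical
  set A := (hfin m).toFinset with hA
  set D := (hfin (m + G.dist v w)).toFinset with hD
  -- Images of the `m`-ball lie within `m + dist v w` of `v`. Excluding `P = ∅` removes the summand
  -- 1; `0 < m` is kept because rigidity needs a positive radius.
  have hsub : G.sparselyPreserved v w m ⊆ ⋃ P ∈ (A ×ˢ D).powerset.erase ∅,
      {c | 0 < m ∧ ∃ φ : G ≃g G, φ v = w ∧ movedGraphOnSphere φ v m = P ∧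
        3 * √(m : ℝ) * (movedOnSphere φ v m).ncard ≤ (movedOnBall φ v m).ncard ∧
        ∀ x, G.dist v x ≤ m → c (φ x) = c x} := by
    rintro c ⟨hm, φ, hφ, hne, hle, hc⟩
    have hP : (movedGraphOnSphere φ v m).Finite := (movedOnSphere_finite (hfin m) φ).image _
    simp only [Set.mem_iUnion]
    refine ⟨hP.toFinset, ?_, (Nat.zero_le _).trans_lt hm, φ, hφ, by simp, hle, hc⟩
    rw [Finset.mem_erase, Finset.mem_powerset, ← Finset.nonempty_iff_ne_empty,
      Set.Finite.toFinset_nonempty]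
    refine ⟨hne.image _, fun p hp => ?_⟩
    obtain ⟨x, hx, rfl⟩ := hP.mem_toFinset.1 hp
    rw [Finset.mem_product, hA, hD, Set.Finite.mem_toFinset, Set.Finite.mem_toFinset]
    refine ⟨hx.1.le, ?_⟩
    have h1 := hconn.dist_triangle (u := v) (v := φ v) (w := φ x)
    have h2 : G.dist (φ v) (φ x) ≤ m := by
      obtain ⟨p, hp⟩ := hconn.exists_walk_length_eq_dist v x
      have := dist_le (p.map φ.toHom)
      rw [Walk.length_map, hp, hx.1] at this
      exact this
    rw [hφ] at h1 h2
    show G.dist v (φ x) ≤ m + G.dist v w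
    omega
  calc randomColouring V (G.sparselyPreserved v w m)
      ≤ ∑ P ∈ (A ×ˢ D).powerset.erase ∅,
          ENNReal.ofReal (((2 : ℝ) ^ (-√(m : ℝ))) ^ P.card) := by
        refine (measure_mono hsub).trans ((measure_biUnion_finset_le _ _).trans
          (Finset.sum_le_sum fun P _ => ?_))
        rcases Nat.eq_zero_or_pos m with hm | hm
        · simp [hm]
        · simp only [hm, true_and]
          exact measure_preserved_of_movedGraph_le hmot hconn hm (hfin m) P
    _ = _ := by
        rw [← ENNReal.ofReal_sum_of_nonneg (fun P _ => by positivity),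
          sum_powerset_erase_empty_pow, Finset.card_product,
          Set.ncard_eq_toFinset_card _ (hfin m),
          Set.ncard_eq_toFinset_card _ (hfin (m + G.dist v w))]

theorem tsum_measure_sparselyPreserved_ne_top (hmot : G.InfiniteMotion) (hconn : G.Connected)
    {v : V} (hfin : ∀ n, {x | G.dist v x ≤ n}.Finite) {C a : ℝ} (ha0 : 0 ≤ a)
    (ha : a < 1 / 2) (hgrowth : ∀ n : ℕ, ({x | G.dist v x ≤ n}.ncard : ℝ) ≤
      C * 2 ^ (a * √(n : ℝ))) (w : V) :
    ∑' m, randomColouring V (G.sparselyPreserved v w m) ≠ ⊤ := by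
  set d := G.dist v w
  set K := C ^ 2 * (2 : ℝ) ^ (a * √(d : ℝ))
  have hK : 0 ≤ K := by positivity
  have hbound : ∀ m : ℕ, randomColouring V (G.sparselyPreserved v w m) ≤
      ENNReal.ofReal (K * (2 : ℝ) ^ (-((1 - 2 * a) * √(m : ℝ))) * Real.exp K) := by
    intro m
    refine (measure_sparselyPreserved_le hmot hconn hfin w m).trans
      (ENNReal.ofReal_le_ofReal ?_)
    -- The two balls contribute `2^(2a√m)` up to a constant, against `2^(-√m)`: this is where the
    -- threshold `1/2` for `a` arises.
    have hNq : (({x | G.dist v x ≤ m}.ncard * {x | G.dist v x ≤ m + d}.ncard : ℕ) : ℝ) *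
        (2 : ℝ) ^ (-√(m : ℝ)) ≤ K * (2 : ℝ) ^ (-((1 - 2 * a) * √(m : ℝ))) := by
      have h1 := hgrowth m
      have h2 := hgrowth (m + d)
      have hsqrt : √((m + d : ℕ) : ℝ) ≤ √(m : ℝ) + √(d : ℝ) := by
        push_cast
        refine (Real.sqrt_le_left (by positivity)).2 ?_
        nlinarith [Real.sq_sqrt (Nat.cast_nonneg (α := ℝ) m),
          Real.sq_sqrt (Nat.cast_nonneg (α := ℝ) d),
          mul_nonneg (Real.sqrt_nonneg (m : ℝ)) (Real.sqrt_nonneg (d : ℝ))]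
      have hCC : (0 : ℝ) ≤ C ^ 2 := sq_nonneg C
      push_cast
      calc ({x | G.dist v x ≤ m}.ncard : ℝ) * {x | G.dist v x ≤ m + d}.ncard *
            (2 : ℝ) ^ (-√(m : ℝ))
          ≤ (C * 2 ^ (a * √(m : ℝ))) * (C * 2 ^ (a * √((m + d : ℕ) : ℝ))) *
            (2 : ℝ) ^ (-√(m : ℝ)) :=
            mul_le_mul_of_nonneg_right (mul_le_mul h1 h2 (Nat.cast_nonneg _)
              ((Nat.cast_nonneg _).trans h1)) (by positivity)
        _ = C ^ 2 * 2 ^ (a * √(m : ℝ) + a * √((m + d : ℕ) : ℝ) + -√(m : ℝ)) := by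
            rw [Real.rpow_add two_pos, Real.rpow_add two_pos]; ring
        _ ≤ C ^ 2 * 2 ^ (a * √(d : ℝ) + -((1 - 2 * a) * √(m : ℝ))) := by
            refine mul_le_mul_of_nonneg_left
              (Real.rpow_le_rpow_of_exponent_le one_le_two ?_) hCC
            nlinarith
        _ = K * (2 : ℝ) ^ (-((1 - 2 * a) * √(m : ℝ))) := by
            rw [Real.rpow_add two_pos]; ring
    have hle : K * (2 : ℝ) ^ (-((1 - 2 * a) * √(m : ℝ))) ≤ K := by
      refine mul_le_of_le_one_right hK (Real.rpow_le_one_of_one_le_of_nonpos one_le_two ?_)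
      have : 0 ≤ (1 - 2 * a) * √(m : ℝ) := mul_nonneg (by linarith) (Real.sqrt_nonneg _)
      linarith
    exact (one_add_pow_sub_one_le (by positivity) (hNq.trans hle)).trans
      (mul_le_mul_of_nonneg_right hNq (Real.exp_pos K).le)
  refine ne_top_of_le_ne_top ?_ (ENNReal.tsum_le_tsum hbound)
  rw [← ENNReal.ofReal_tsum_of_nonneg (fun m => by positivity)]
  · exact ENNReal.ofReal_ne_top
  · exact ((summable_two_rpow_neg_mul_sqrt (by linarith)).mul_left K).mul_right _

/-! ### Sparse spheres occur infinitely often; Borel–Cantelli -/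

theorem frequently_mem_sparselyPreserved (hmot : G.InfiniteMotion) (hconn : G.Connected)
    {v : V} (hfin : ∀ n, {x | G.dist v x ≤ n}.Finite) {C a : ℝ} (hC : 0 ≤ C)
    (ha : a ≤ 1 / 2) (hgrowth : ∀ n : ℕ, ({x | G.dist v x ≤ n}.ncard : ℝ) ≤
      C * 2 ^ (a * √(n : ℝ))) {c : V → Bool} {φ : G ≃g G} (hc : c ∘ φ = c)
    (hφ : φ ≠ RelIso.refl G.Adj) :
    ∃ᶠ m in Filter.atTop, c ∈ G.sparselyPreserved v (φ v) m := by
  obtain ⟨x, hx⟩ : ∃ x, φ x ≠ x := by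
    by_contra! h
    exact hφ (RelIso.ext h)
  rw [Filter.frequently_atTop]
  intro N
  set M := max N (max (G.dist v (φ v)) (G.dist v x)) with hM
  have hMN : N ≤ M := le_max_left _ _
  have hMv : G.dist v (φ v) ≤ M := (le_max_left _ _).trans (le_max_right _ _)
  have hMx : G.dist v x ≤ M := (le_max_right _ _).trans (le_max_right _ _)
  have hpos : (0 : ℝ) < (movedOnBall φ v M).ncard := by
    exact_mod_cast (Set.ncard_pos (movedOnBall_finite (hfin M) φ)).2 ⟨x, hMx, hx⟩
  have hmono : Monotone fun n => ((movedOnBall φ v n).ncard : ℝ) := fun i j hij => by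
    have hsub : movedOnBall φ v i ⊆ movedOnBall φ v j := fun y hy => ⟨hy.1.trans hij, hy.2⟩
    exact Nat.cast_le.2 (Set.ncard_le_ncard hsub (movedOnBall_finite (hfin j) φ))
  have hT : ∀ n : ℕ, ((movedOnBall φ v n).ncard : ℝ) ≤ C * 2 ^ (a * √(n : ℝ)) := by
    intro n
    have hsub : movedOnBall φ v n ⊆ {x | G.dist v x ≤ n} := fun y hy => hy.1
    exact (Nat.cast_le.2 (Set.ncard_le_ncard hsub (hfin n))).trans (hgrowth n)
  obtain ⟨m, hm, hle⟩ := exists_ge_mul_increment_le ha hC hT hpos hmono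
  have hlt : G.dist v (φ v) < m + 1 := by omega
  refine ⟨m + 1, by omega, hlt, φ, rfl, ?_, ?_, fun y _ => congrFun hc y⟩
  -- If the whole sphere were fixed, rigidity would fix the ball, which contains the moved vertex
  -- `x`.
  · by_contra hemp
    refine hx (hmot.fix_ball_of_fix_sphere hconn φ (hfin (m + 1)) hlt (fun y hy => ?_) x
      (by omega))
    by_contra hy'
    exact hemp ⟨y, hy, hy'⟩
  · have h := ncard_movedOnBall_succ (hfin (m + 1)) φ
    have h' : ((movedOnSphere φ v (m + 1)).ncard : ℝ) =
        (movedOnBall φ v (m + 1)).ncard - (movedOnBall φ v m).ncard := by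
      rw [h]; push_cast; ring
    rw [h']
    exact hle

theorem countable_of_finite_balls {v : V}
    (hfin : ∀ n, {x | G.dist v x ≤ n}.Finite) : Countable V := by
  rw [← Set.countable_univ_iff]
  refine (Set.countable_iUnion fun n => (hfin n).countable).mono fun x _ => ?_
  exact Set.mem_iUnion.2 ⟨G.dist v x, le_refl (G.dist v x)⟩

theorem Connected.distBall_eq (hconn : G.Connected) (v : V) (n : ℕ) :
    G.distBall v n = {x | G.dist v x ≤ n} := by
  ext x
  rw [distBall, Set.mem_ofPred_eq, Set.mem_ofPred_eq, ← (hconn v x).coe_dist_eq_edist,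
    Nat.cast_le]

end SimpleGraph

theorem mainTheorem5 {V : Type*} (G : SimpleGraph V) (hconn : G.Connected)
    (hmotion : G.InfiniteMotion) (ε : ℝ) (hε : 0 < ε)
    (hgrowth : G.HasGrowth fun n : ℕ => (2 : ℝ) ^ ((1 / 2 - ε) * Real.sqrt (n : ℝ))) :
    ∀ᵐ c ∂(randomColouring V), G.IsDistinguishing c := by
  obtain ⟨v, C, hball⟩ := hgrowth
  simp only [hconn.distBall_eq] at hball
  have hfin := fun n => (hball n).1
  have hC : 0 ≤ C := by
    have h := (Nat.cast_nonneg _).trans (hball 0).2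
    simpa using h
  -- The maximum keeps the exponent nonnegative for large `ε`; any constant in `[0, 1/2)` would
  -- serve.
  set a := max (1 / 2 - ε) (1 / 4)
  have ha : a < 1 / 2 := max_lt (by linarith) (by norm_num)
  have ha0 : 0 ≤ a := le_trans (by norm_num) (le_max_right _ _)
  have hbound : ∀ n : ℕ, ({x | G.dist v x ≤ n}.ncard : ℝ) ≤ C * 2 ^ (a * √(n : ℝ)) := fun n =>
    (hball n).2.trans (mul_le_mul_of_nonneg_left
      (Real.rpow_le_rpow_of_exponent_le one_le_two
        (mul_le_mul_of_nonneg_right (le_max_left _ _) (Real.sqrt_nonneg _))) hC)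
  have := SimpleGraph.countable_of_finite_balls hfin
  have hae : ∀ᵐ c ∂(randomColouring V), ∀ w, ∀ᶠ m in Filter.atTop,
      c ∉ G.sparselyPreserved v w m :=
    ae_all_iff.2 fun w => ae_eventually_notMem
      (SimpleGraph.tsum_measure_sparselyPreserved_ne_top hmotion hconn hfin ha0 ha hbound w)
  filter_upwards [hae] with c hc φ hφ
  by_contra hne
  exact SimpleGraph.frequently_mem_sparselyPreserved hmotion hconn hfin hC ha.le hbound hφ hne
    (hc (φ v))
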